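/- Let $k$ be an algebraically closed field of characteristic $0$ and let $H=\bigoplus_{n\ge 0}H_n$ be a finite-dimensional graded Hopf algebra over $k$ (product, unit, coproduct, counit and antipode $S$ respect the grading) such that $H_0\cong kG$ as Hopf algebras for a finite abelian group $G$. Let $G(H)$ be the group of group-like elements of $H$ and $G(H^*)=\mathrm{Alg}(H,k)$ the group of algebra maps $H\to k$ with the convolution product $(\beta\beta')(h)=\sum\beta(h_1)\beta'(h_2)$. A (left-right) Yetter-Drinfel'd $H$-module is a left $H$-module and right $H$-comodule $M$, with coaction $m\mapsto\sum m_0\otimes m_1\in M\otimes H$, such that $\sum h_1\cdot m_0\otimes h_2m_1=\sum (h_2\cdot m)_0\otimes (h_2\cdot m)_1h_1$ for all $h\in H$, $m\in M$. The tensor product $M\otimes N$ of two such modules has action $h\cdot(m\otimes n)=\sum h_1\cdot m\otimes h_2\cdot n$ and coaction $m\otimes n\mapsto\sum m_0\otimes n_0\otimes n_1m_1$. For $\beta\in G(H^*)$, let $H_\beta$ be the Yetter-Drinfel'd module $H$ with action $h\rightharpoonup_\beta a=\sum\beta(h_2)\,h_3\,a\,S^{-1}(h_1)$ and coaction the coproduct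 of $H$; for $g\in G(H)$, let $H\rightharpoonup_\beta g=\{h\rightharpoonup_\beta g: h\in H\}$, a Yetter-Drinfel'd submodule of $H_\beta$. Let $\beta,\beta'\in G(H^*)$ and $g,g'\in G(H)$. If $(H\rightharpoonup_\beta g)\otimes(H\rightharpoonup_{\beta'}g')$ is a simple Yetter-Drinfel'd module, then $$(H\rightharpoonup_\beta g)\otimes(H\rightharpoonup_{\beta'}g')\;\cong\; H\rightharpoonup_{\beta\beta'}gg'$$ as Yetter-Drinfel'd modules. -/

import Mathlib

set_option linter.unusedSimpArgs false
set_option linter.unusedSectionVars false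

section
open scoped TensorProduct
open Coalgebra HopfAlgebra WithConv

namespace HopfAux
section Main
variable {k H V : Type*} [Field k] [Ring H] [HopfAlgebra k H] [AddCommGroup V] [Module k V]

theorem lift_comul {C : Type*} [AddCommGroup C] [Module k C] [Coalgebra k C]
    (B : C →ₗ[k] C →ₗ[k] V) (h : C) :
    TensorProduct.lift B (comul h) =
      ∑ i ∈ (ℛ k h).index, B ((ℛ k h).left i) ((ℛ k h).right i) := by
  rw [← (ℛ k h).eq]; simp

theorem sum_coassoc {H : Type*} [AddCommGroup H] [Module k H] [Coalgebra k H]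
    (T : H →ₗ[k] H →ₗ[k] H →ₗ[k] V) (h : H) :
    ∑ i ∈ (ℛ k h).index, ∑ j ∈ (ℛ k ((ℛ k h).left i)).index,
      T ((ℛ k ((ℛ k h).left i)).left j) ((ℛ k ((ℛ k h).left i)).right j) ((ℛ k h).right i) =
    ∑ i ∈ (ℛ k h).index, ∑ j ∈ (ℛ k ((ℛ k h).right i)).index,
      T ((ℛ k h).left i) ((ℛ k ((ℛ k h).right i)).left j) ((ℛ k ((ℛ k h).right i)).right j) := by
  have := congrArg (TensorProduct.lift ((TensorProduct.lift.equiv (.id k) H H V).toLinearMap ∘ₗ T))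
   (sum_tmul_tmul_eq (ℛ k h) (fun i => ℛ k ((ℛ k h).left i)) (fun i => ℛ k ((ℛ k h).right i)))
  simpa [map_sum] using this

/-- A trilinear map from a function that is linear in each argument. -/
noncomputable def mk₃ {X Y Z W : Type*} [AddCommGroup X] [Module k X] [AddCommGroup Y]
    [Module k Y] [AddCommGroup Z] [Module k Z] [AddCommGroup W] [Module k W]
    (f : X → Y → Z → W)
    (h1 : ∀ x x' y z, f (x + x') y z = f x y z + f x' y z)
    (h1' : ∀ (c : k) x y z, f (c • x) y z = c • f x y z)
    (h2 : ∀ x y y' z, f x (y + y') z = f x y z + f x y' z)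
    (h2' : ∀ (c : k) x y z, f x (c • y) z = c • f x y z)
    (h3 : ∀ x y z z', f x y (z + z') = f x y z + f x y z')
    (h3' : ∀ (c : k) x y z, f x y (c • z) = c • f x y z) :
    X →ₗ[k] Y →ₗ[k] Z →ₗ[k] W where
  toFun x := LinearMap.mk₂ k (f x) (h2 x) (fun c y z => h2' c x y z) (h3 x)
    (fun c y z => h3' c x y z)
  map_add' x x' := by ext; simp [h1]
  map_smul' c x := by ext; simp [h1']

/-- Right translation of functionals: `(a ⇀ f)(x) = f (x a)`. -/
noncomputable def hit : H →ₗ[k] Module.Dual k H →ₗ[k] Module.Dual k H :=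
  LinearMap.mk₂ k (fun a f => f ∘ₗ LinearMap.mulRight k a)
    (by intros; ext; simp [mul_add]) (by intros; ext; simp)
    (by intros; ext; simp) (by intros; ext; simp)

@[simp] theorem hit_apply (a : H) (f : Module.Dual k H) (x : H) : hit a f x = f (x * a) := rfl

/-- The convolution product of functionals: `(f g)(x) = ∑ f(x₁) g(x₂)`. -/
noncomputable def cv : Module.Dual k H →ₗ[k] Module.Dual k H →ₗ[k] Module.Dual k H :=
  LinearMap.mk₂ k (fun f g => LinearMap.mul' k k ∘ₗ TensorProduct.map f g ∘ₗ comul)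
    (by intros; ext; simp [TensorProduct.map_add_left]) (by intros; ext; simp [TensorProduct.map_smul_left])
    (by intros; ext; simp [TensorProduct.map_add_right]) (by intros; ext; simp [TensorProduct.map_smul_right])

theorem cv_apply (f g : Module.Dual k H) (x : H) :
    cv f g x = LinearMap.mul' k k (TensorProduct.map f g (comul x)) := rfl

theorem cv_apply_sum (f g : Module.Dual k H) (x : H) :
    cv f g x = ∑ i ∈ (ℛ k x).index, f ((ℛ k x).left i) * g ((ℛ k x).right i) := by
  rw [cv_apply, ← (ℛ k x).eq]; simp

theorem cv_assoc (f g h : Module.Dual k H) : cv (cv f g) h = cv f (cv g h) :=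
  congrArg WithConv.ofConv (mul_assoc (toConv f) (toConv g) (toConv h))

theorem counit_cv (f : Module.Dual k H) : cv counit f = f :=
  congrArg WithConv.ofConv (one_mul (toConv f))

theorem conv_left_comul :
    (toConv (comul (R := k) (A := H))) =
      toConv (Algebra.TensorProduct.includeLeft (R := k) (S := k) (A := H) (B := H)).toLinearMap *
      toConv (Algebra.TensorProduct.includeRight (R := k) (A := H) (B := H)).toLinearMap := by
  ext h
  rw [(ℛ k h).convMul_apply]
  simp [(ℛ k h).eq]

theorem algHom_conv {A B : Type*} [Ring A] [Algebra k A] [Ring B] [Algebra k B] (F : A →ₐ[k] B)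
    (f g : WithConv (H →ₗ[k] A)) :
    toConv (F.toLinearMap ∘ₗ (f * g).ofConv) =
      toConv (F.toLinearMap ∘ₗ f.ofConv) * toConv (F.toLinearMap ∘ₗ g.ofConv) := by
  ext h
  simp [(ℛ k h).convMul_apply]

theorem algHom_conv_one {A B : Type*} [Ring A] [Algebra k A] [Ring B] [Algebra k B] (F : A →ₐ[k] B) :
    toConv (F.toLinearMap ∘ₗ (1 : WithConv (H →ₗ[k] A)).ofConv) = 1 := by
  ext h
  simp

theorem algHom_mul_antipode {B : Type*} [Ring B] [Algebra k B] (F : H →ₐ[k] B) :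
    toConv F.toLinearMap * toConv (F.toLinearMap ∘ₗ antipode k) = 1 := by
  rw [← algHom_conv_one F, ← LinearMap.id_mul_antipode, algHom_conv]
  rfl

theorem algHom_antipode_mul {B : Type*} [Ring B] [Algebra k B] (F : H →ₐ[k] B) :
    toConv (F.toLinearMap ∘ₗ antipode k) * toConv F.toLinearMap = 1 := by
  rw [← algHom_conv_one F, ← LinearMap.antipode_mul_id, algHom_conv]
  rfl

theorem comul_antipode :
    toConv (comul ∘ₗ antipode k (A := H)) =
      toConv ((Algebra.TensorProduct.includeRight (R := k) (A := H) (B := H)).toLinearMap ∘ₗ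
        antipode k) *
      toConv ((Algebra.TensorProduct.includeLeft (R := k) (S := k) (A := H) (B := H)).toLinearMap ∘ₗ
        antipode k) := by
  symm
  apply left_inv_eq_right_inv (a := toConv (comul (R := k) (A := H)))
  · rw [conv_left_comul, mul_assoc, ← mul_assoc _ _ (toConv
      (Algebra.TensorProduct.includeRight (R := k) (A := H) (B := H)).toLinearMap),
      algHom_antipode_mul, one_mul, algHom_antipode_mul]
  · exact LinearMap.comul_right_inv

theorem comul_antipode_conv :
    toConv (comul ∘ₗ antipode k (A := H)) *
      toConv (Algebra.TensorProduct.includeLeft (R := k) (S := k) (A := H) (B := H)).toLinearMap =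
      toConv ((Algebra.TensorProduct.includeRight (R := k) (A := H) (B := H)).toLinearMap ∘ₗ
        antipode k) := by
  rw [comul_antipode, mul_assoc, algHom_antipode_mul, mul_one]

theorem cv_hit_left (a : H) (p g : Module.Dual k H) (y : H) :
    cv (hit a p) g y = LinearMap.mul' k k (TensorProduct.map p g (comul y * (a ⊗ₜ[k] (1 : H)))) := by
  rw [cv_apply]
  generalize (comul y : H ⊗[k] H) = u
  induction u with
  | zero => simp
  | tmul x y => simp
  | add x y hx hy => rw [map_add, map_add, hx, hy, add_mul, map_add, map_add]

theorem cv_hit_antipode (p g : Module.Dual k H) (h : H) :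
    cv p (hit (antipode k h) g) = ∑ i ∈ (ℛ k h).index,
      hit (antipode k ((ℛ k h).left i)) (cv (hit ((ℛ k h).right i) p) g) := by
  ext x
  have K := congrArg (fun f => f.ofConv h) (comul_antipode_conv (k := k) (H := H))
  simp only [(ℛ k h).convMul_apply] at K
  simp only [LinearMap.sum_apply, hit_apply, cv_hit_left, ← map_sum]
  have : ∑ i ∈ (ℛ k h).index, comul (x * antipode k ((ℛ k h).left i)) *
      ((ℛ k h).right i ⊗ₜ[k] (1 : H)) = comul x * ((1 : H) ⊗ₜ[k] antipode k h) := by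
    simp only [Bialgebra.comul_mul, mul_assoc, ← Finset.mul_sum]
    congr 1
  rw [this, cv_apply]
  generalize (comul x : H ⊗[k] H) = u
  induction u with
  | zero => simp
  | tmul x y => simp
  | add x y hx hy => rw [map_add, map_add, hx, hy, add_mul, map_add, map_add]

theorem hit_hit (a b : H) (f : Module.Dual k H) : hit a (hit b f) = hit (a * b) f := by
  ext x; simp [mul_assoc]

theorem hit_one (f : Module.Dual k H) : hit 1 f = f := by
  ext x; simp

section Basis
variable {ι : Type*} [Fintype ι] (b : Module.Basis ι k H)

theorem dual_comul (B : Module.Dual k H →ₗ[k] H →ₗ[k] H →ₗ[k] V) :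
    ∑ i, ∑ j, B (cv (b.coord i) (b.coord j)) (b i) (b j) =
    ∑ l, ∑ i ∈ (ℛ k (b l)).index, B (b.coord l) ((ℛ k (b l)).left i) ((ℛ k (b l)).right i) := by
  classical
  have h1 (f : Module.Dual k H) : f = ∑ l, f (b l) • b.coord l := by
    apply b.ext; intro i; simp
  have h2 (x : H) : comul x = ∑ i, ∑ j, cv (b.coord i) (b.coord j) x • (b i ⊗ₜ[k] b j) := by
    simp only [cv_apply]
    generalize (comul x : H ⊗[k] H) = u
    induction u with
    | zero => simp
    | tmul x y =>
      calc x ⊗ₜ[k] y = (∑ i, b.repr x i • b i) ⊗ₜ[k] (∑ j, b.repr y j • b j) := by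
            rw [b.sum_repr, b.sum_repr]
        _ = _ := by
          rw [TensorProduct.sum_tmul]
          simp_rw [TensorProduct.tmul_sum, TensorProduct.smul_tmul_smul]
          simp
    | add x y hx hy => simp only [map_add, add_smul, Finset.sum_add_distrib, ← hx, ← hy]
  have h3 (l : ι) : ∑ i ∈ (ℛ k (b l)).index, B (b.coord l) ((ℛ k (b l)).left i)
      ((ℛ k (b l)).right i) =
      ∑ i, ∑ j, cv (b.coord i) (b.coord j) (b l) • B (b.coord l) (b i) (b j) := by
    rw [← lift_comul, h2]
    simp
  simp_rw [h3]
  rw [Finset.sum_comm]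
  conv_rhs => rw [Finset.sum_comm]; enter [2, i]; rw [Finset.sum_comm]
  rw [Finset.sum_comm]
  refine Finset.sum_congr rfl fun i _ => Finset.sum_congr rfl fun j _ => ?_
  conv_lhs => rw [h1 (cv (b.coord i) (b.coord j))]
  simp only [map_sum, map_smul, LinearMap.sum_apply, LinearMap.smul_apply]

end Basis

theorem cv_hit_antipode_antipode (p g : Module.Dual k H) (a : H) :
    cv p (hit (antipode k (antipode k a)) g) = ∑ i ∈ (ℛ k a).index,
      hit (antipode k (antipode k ((ℛ k a).right i)))
        (cv (hit (antipode k ((ℛ k a).left i)) p) g) := by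
  have K := congrArg (fun f => f.ofConv a) (comul_antipode (k := k) (H := H))
  simp only [(ℛ k a).convMul_apply] at K
  have := lift_comul ((hit ∘ₗ antipode k).compl₂ (cv.flip g ∘ₗ hit.flip p)) (antipode k a)
  simp only [LinearMap.compl₂_apply, LinearMap.comp_apply, LinearMap.flip_apply] at this
  rw [cv_hit_antipode, ← this]
  erw [K]
  simp

theorem sum_cv_hit {ι : Type*} [Fintype ι] (b : Module.Basis ι k H) (p : Module.Dual k H) :
    ∑ i, cv (hit (antipode k (b i)) p) (b.coord i) = p 1 • counit := by
  ext x
  have h1 (y z : H) : ∑ i, p (y * antipode k (b i)) * b.coord i z = p (y * antipode k z) := by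
    conv_rhs => rw [← b.sum_repr z]
    rw [map_sum, Finset.mul_sum, map_sum]
    simp [mul_comm]
  simp only [LinearMap.sum_apply, cv_apply_sum, hit_apply]
  rw [Finset.sum_comm]
  simp only [h1]
  rw [← map_sum, sum_mul_antipode_eq_smul]
  simp [mul_comm]

/-- A linear endomorphism of the dual whose values are integrals on `H`. -/
noncomputable def integ {ι : Type*} [Fintype ι] (b : Module.Basis ι k H) (f : Module.Dual k H) :
    Module.Dual k H := ∑ i, hit (antipode k (antipode k (b i))) (cv (b.coord i) f)

theorem cv_integ {ι : Type*} [Fintype ι] (b : Module.Basis ι k H) (p f : Module.Dual k H) :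
    cv p (integ b f) = p 1 • integ b f := by
  unfold integ
  simp only [map_sum, cv_hit_antipode_antipode]
  have := dual_comul b (mk₃ (k := k) (X := Module.Dual k H) (Y := H) (Z := H) (fun c x y =>
      hit (antipode k (antipode k y)) (cv (hit (antipode k x) p) (cv c f)))
      (by simp) (by simp) (by simp) (by simp) (by simp) (by simp))
  simp only [mk₃, LinearMap.coe_mk, AddHom.coe_mk, LinearMap.mk₂_apply] at this
  rw [← this, Finset.sum_comm, Finset.smul_sum]
  refine Finset.sum_congr rfl fun j _ => ?_
  have h (i) : cv (hit (antipode k (b i)) p) (cv (cv (b.coord i) (b.coord j)) f) =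
      cv (cv (hit (antipode k (b i)) p) (b.coord i)) (cv (b.coord j) f) := by
    rw [cv_assoc, cv_assoc]
  simp_rw [← map_sum, h]
  rw [← LinearMap.sum_apply, ← map_sum, sum_cv_hit]
  simp [counit_cv]

theorem sum_hit_integ {ι : Type*} [Fintype ι] (b : Module.Basis ι k H) (f : Module.Dual k H) :
    ∑ i, hit (antipode k (b i)) (integ b (cv (b.coord i) f)) = f := by
  unfold integ
  simp only [map_sum, hit_hit, ← cv_assoc]
  rw [Finset.sum_comm]
  have := dual_comul b (mk₃ (k := k) (X := Module.Dual k H) (Y := H) (Z := H) (fun c x y =>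
      hit (antipode k y * antipode k (antipode k x)) (cv c f))
      (by simp) (by simp) (by simp [mul_add]) (by simp) (by simp [add_mul]) (by simp))
  simp only [mk₃, LinearMap.coe_mk, AddHom.coe_mk, LinearMap.mk₂_apply] at this
  rw [this]
  simp only [← antipode_mul_antidistrib]
  simp only [← LinearMap.sum_apply, ← map_sum, sum_antipode_mul_eq_smul]
  have h1 (f : Module.Dual k H) : f = ∑ l, f (b l) • b.coord l := by
    apply b.ext; intro i; simp
  conv_rhs => rw [← counit_cv f, h1 counit, map_sum, LinearMap.sum_apply]
  simp [hit_one]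

/-- A finite-dimensional Hopf algebra has a nonzero left integral in its dual. -/
theorem exists_integral [FiniteDimensional k H] :
    ∃ t : Module.Dual k H, t ≠ 0 ∧ ∀ p, cv p t = p 1 • t := by
  by_contra! hc
  let b := Module.finBasis k H
  have h0 (f : Module.Dual k H) : integ b f = 0 := by
    by_contra h
    obtain ⟨p, hp⟩ := hc _ h
    exact hp (cv_integ b p f)
  have h1 := sum_hit_integ b (counit : Module.Dual k H)
  simp only [h0, map_zero, Finset.sum_const_zero] at h1
  have := LinearMap.congr_fun h1 (1 : H)
  simp at this

/-- The antipode of a finite-dimensional Hopf algebra is injective, hence bijective. -/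
theorem antipode_injective [FiniteDimensional k H] :
    Function.Injective (antipode k (A := H)) := by
  rw [injective_iff_map_eq_zero]
  intro h hh
  obtain ⟨t, ht0, ht⟩ := exists_integral (k := k) (H := H)
  let b := Module.finBasis k H
  have h1 (p : Module.Dual k H) : ∑ i ∈ (ℛ k h).index,
      p ((ℛ k h).right i) • hit (antipode k ((ℛ k h).left i)) t = 0 := by
    have := cv_hit_antipode p t h
    rw [hh] at this
    simpa [ht] using this.symm
  have h2 (q : Module.Dual k H) : q h • t = 0 := by
    have h3 : ∑ j, hit (antipode k (antipode k (b j))) (∑ i ∈ (ℛ k h).index,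
      cv (b.coord j) q ((ℛ k h).right i) • hit (antipode k ((ℛ k h).left i)) t) = 0 := by
      simp [h1]
    have h4 (x : H) : ∑ j, cv (b.coord j) q x • antipode k (b j) =
        ∑ i ∈ (ℛ k x).index, q ((ℛ k x).right i) • antipode k ((ℛ k x).left i) := by
      simp only [cv_apply_sum, Finset.sum_smul]
      rw [Finset.sum_comm]
      refine Finset.sum_congr rfl fun i _ => ?_
      conv_rhs => rw [← b.sum_repr ((ℛ k x).left i)]
      rw [map_sum, Finset.smul_sum]
      refine Finset.sum_congr rfl fun j _ => ?_
      simp [smul_smul, mul_comm]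
    have h5 (a x : H) : ∑ j, hit (antipode k (antipode k (b j)))
        (cv (b.coord j) q x • hit (antipode k a) t) =
        ∑ i ∈ (ℛ k x).index, q ((ℛ k x).right i) •
          hit (antipode k (a * antipode k ((ℛ k x).left i))) t := by
      have := congrArg (fun y => hit (antipode k (a * y)) t) (h4 x)
      simpa [hit_hit, antipode_mul_antidistrib, Finset.mul_sum] using this
    simp only [map_sum] at h3
    rw [Finset.sum_comm] at h3
    simp only [h5] at h3
    have h6 := sum_coassoc (mk₃ (k := k) (X := H) (Y := H) (Z := H) (fun x y z =>
      q z • hit (antipode k (x * antipode k y)) t)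
      (by simp [add_mul]) (fun c x y z => by simp [smul_comm (q z) c]) (by simp [mul_add])
      (fun c x y z => by simp [smul_comm (q z) c])
      (by simp [add_smul]) (by simp [mul_smul])) h
    simp only [mk₃, LinearMap.coe_mk, AddHom.coe_mk, LinearMap.mk₂_apply] at h6
    rw [← h6] at h3
    simp only [← Finset.smul_sum, ← LinearMap.sum_apply, ← map_sum,
      sum_mul_antipode_eq_smul] at h3
    simp only [map_smul, antipode_one, LinearMap.smul_apply, hit_one, smul_smul, ← Finset.sum_smul] at h3
    have h7 : ∑ i ∈ (ℛ k h).index, q ((ℛ k h).right i) * counit ((ℛ k h).left i) = q h := by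
      conv_rhs => rw [← sum_counit_smul (ℛ k h)]
      simp [mul_comm]
    rwa [h7] at h3
  rw [← Module.forall_dual_apply_eq_zero_iff k]
  exact fun q => (smul_eq_zero.mp (h2 q)).resolve_right ht0

end Main
end HopfAux


/-- A left-right Yetter-Drinfel'd module structure over a bialgebra `H` on the vector space `V`. -/
structure YetterDrinfeldModule (k H V : Type*) [Field k] [Ring H] [Bialgebra k H]
    [AddCommGroup V] [Module k V] where
  /-- The left `H`-module structure, as a representation `H → End V`. -/
  act : H →ₐ[k] Module.End k V
  /-- The right `H`-comodule structure `δ(m) = ∑ m₀ ⊗ m₁`. -/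
  coact : V →ₗ[k] V ⊗[k] H
  coact_coassoc : TensorProduct.assoc k V H H ∘ₗ coact.rTensor H ∘ₗ coact =
    (comul (R := k) (A := H)).lTensor V ∘ₗ coact
  coact_counit : (counit (R := k) (A := H)).lTensor V ∘ₗ coact = (TensorProduct.mk k V k).flip 1
  /-- `∑ h₁ · m₀ ⊗ h₂ m₁ = ∑ (h₂ · m)₀ ⊗ (h₂ · m)₁ h₁`, where `ℛ k h` is a chosen way of writing
  `Δ h = ∑ h₁ ⊗ h₂`; both sides depend on `Δ h` only. -/
  compat : ∀ (h : H) (m : V),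
    ∑ i ∈ (ℛ k h).index, TensorProduct.map (act ((ℛ k h).left i))
        (LinearMap.mulLeft k ((ℛ k h).right i)) (coact m) =
      ∑ i ∈ (ℛ k h).index, (LinearMap.mulRight k ((ℛ k h).left i)).lTensor V
        (coact (act ((ℛ k h).right i) m))

namespace HopfAux

section conv
variable {k H A : Type*} [Field k] [Ring H] [Bialgebra k H] [Semiring A] [Algebra k A]

/-- The convolution product `h ↦ ∑ f(h₁) g(h₂)` of two algebra maps with commuting images; it is an
algebra map. -/
noncomputable def algConv (f g : H →ₐ[k] A) (hfg : ∀ x y, Commute (f x) (g y)) : H →ₐ[k] A :=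
  (Algebra.TensorProduct.lift f g hfg).comp (Bialgebra.comulAlgHom k H)

theorem algConv_apply (f g : H →ₐ[k] A) (hfg : ∀ x y, Commute (f x) (g y)) (h : H) :
    algConv f g hfg h =
      ∑ i ∈ (ℛ k h).index, f ((ℛ k h).left i) * g ((ℛ k h).right i) := by
  simp only [algConv, AlgHom.comp_apply, Bialgebra.comulAlgHom_apply]
  rw [← (ℛ k h).eq]; simp

theorem toConv_algConv (f g : H →ₐ[k] A) (hfg : ∀ x y, Commute (f x) (g y)) :
    toConv (algConv f g hfg).toLinearMap = toConv f.toLinearMap * toConv g.toLinearMap := by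
  ext h
  simp [(ℛ k h).convMul_apply, algConv_apply]
end conv

section
variable {k H : Type*} [Field k] [Ring H] [HopfAlgebra k H] [FiniteDimensional k H]

variable (k H) in
/-- The antipode of a finite-dimensional Hopf algebra, as a linear equivalence. -/
noncomputable def antipodeEquiv : H ≃ₗ[k] H :=
  LinearEquiv.ofBijective (antipode k)
    ⟨antipode_injective, LinearMap.surjective_of_injective antipode_injective⟩

variable (k) in
/-- The inverse `S⁻¹` of the antipode. -/
noncomputable def antipodeInv : H →ₗ[k] H := (antipodeEquiv k H).symm.toLinearMap

@[simp] theorem antipode_antipodeInv (a : H) : antipode k (antipodeInv k a) = a :=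
  (antipodeEquiv k H).apply_symm_apply a

@[simp] theorem antipodeInv_antipode (a : H) : antipodeInv k (antipode k a) = a :=
  (antipodeEquiv k H).symm_apply_apply a

theorem antipodeInv_mul (a b : H) :
    antipodeInv k (a * b) = antipodeInv k b * antipodeInv k a :=
  antipode_injective (k := k) (by simp [antipode_mul_antidistrib])

@[simp] theorem antipodeInv_one : antipodeInv k (1 : H) = 1 :=
  antipode_injective (k := k) (by simp)

theorem sum_right_mul_antipodeInv_left (h : H) :
    ∑ i ∈ (ℛ k h).index, (ℛ k h).right i * antipodeInv k ((ℛ k h).left i) =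
      counit (R := k) h • 1 :=
  antipode_injective (k := k) (by
    simp [antipode_mul_antidistrib, sum_mul_antipode_eq_smul])

theorem sum_antipodeInv_right_mul_left (h : H) :
    ∑ i ∈ (ℛ k h).index, antipodeInv k ((ℛ k h).right i) * (ℛ k h).left i =
      counit (R := k) h • 1 :=
  antipode_injective (k := k) (by
    simp [antipode_mul_antidistrib, sum_antipode_mul_eq_smul])

variable (k H) in
/-- `h ↦ (a ↦ a S⁻¹(h))`. -/
noncomputable def mulRightAntipodeInv : H →ₐ[k] Module.End k H :=
  AlgHom.ofLinearMap ((LinearMap.mul k H).flip ∘ₗ antipodeInv k)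
    (by ext; simp) (by intro x y; ext; simp [antipodeInv_mul, mul_assoc])

theorem mulRightAntipodeInv_apply (h a : H) :
    mulRightAntipodeInv k H h a = a * antipodeInv k h := rfl

/-- `h ↦ (a ↦ ∑ β(h₁) h₂ a)`. -/
noncomputable def betaMulLeft (β : H →ₐ[k] k) : H →ₐ[k] Module.End k H :=
  algConv ((Algebra.ofId k (Module.End k H)).comp β) (Algebra.lmul k H)
    (fun x _ => Algebra.commutes (β x) _)

theorem betaMulLeft_apply (β : H →ₐ[k] k) (h a : H) : betaMulLeft β h a =
    ∑ i ∈ (ℛ k h).index, β ((ℛ k h).left i) • ((ℛ k h).right i * a) := by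
  rw [show betaMulLeft β h = _ from algConv_apply _ _ _ h]
  simp [Algebra.ofId_apply]

/-- The action `h ·_β a = ∑ β(h₂) h₃ a S⁻¹(h₁)` of `H` on itself; see `betaAct_apply`. -/
noncomputable def betaAct (β : H →ₐ[k] k) : H →ₐ[k] Module.End k H :=
  algConv (mulRightAntipodeInv k H) (betaMulLeft β) (fun x y => by
    ext a
    simp [betaMulLeft_apply, mulRightAntipodeInv_apply, Finset.sum_mul, mul_assoc])

theorem betaAct_apply (β : H →ₐ[k] k) (h a : H) : betaAct β h a =
    ∑ i ∈ (ℛ k h).index, ∑ j ∈ (ℛ k ((ℛ k h).right i)).index,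
      β ((ℛ k ((ℛ k h).right i)).left j) •
        ((ℛ k ((ℛ k h).right i)).right j * a * antipodeInv k ((ℛ k h).left i)) := by
  rw [show betaAct β h = _ from algConv_apply _ _ _ h]
  simp [betaMulLeft_apply, mulRightAntipodeInv_apply, Finset.sum_mul]

theorem regular_compat (β : H →ₐ[k] k) (h a : H) :
    ∑ i ∈ (ℛ k h).index, TensorProduct.map (betaAct β ((ℛ k h).left i))
        (LinearMap.mulLeft k ((ℛ k h).right i)) (comul a) =
      ∑ i ∈ (ℛ k h).index, (LinearMap.mulRight k ((ℛ k h).left i)).lTensor H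
        (comul (betaAct β ((ℛ k h).right i) a)) := by
  let A1 := Module.End.rTensorAlgHom k H H
  let A2 := Module.End.lTensorAlgHom k H H
  have hA1 (f : Module.End k H) (x y : H) : A1 f (x ⊗ₜ[k] y) = f x ⊗ₜ[k] y := rfl
  have hA2 (f : Module.End k H) (x y : H) : A2 f (x ⊗ₜ[k] y) = x ⊗ₜ[k] f y := rfl
  let ρ : H →ₗ[k] Module.End k H := (LinearMap.mul k H).flip
  let ρ' : H →ₗ[k] Module.End k H := (mulRightAntipodeInv k H).toLinearMap
  let b : H →ₗ[k] Module.End k (H ⊗[k] H) := ((Algebra.ofId k _).comp β).toLinearMap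
  let lam : H →ₗ[k] Module.End k H := (Algebra.lmul k H).toLinearMap
  let Ld : H →ₗ[k] Module.End k (H ⊗[k] H) := (Algebra.lmul k (H ⊗[k] H)).toLinearMap ∘ₗ comul
  let q : H →ₗ[k] Module.End k (H ⊗[k] H) := (LinearMap.mul k (H ⊗[k] H)).flip ∘ₗ comul ∘ₗ antipodeInv k
  let p' : H →ₗ[k] Module.End k (H ⊗[k] H) := (LinearMap.mul k (H ⊗[k] H)).flip ∘ₗ comul
  have hρρ' : toConv ρ * toConv ρ' = 1 := by
    ext x y
    rw [(ℛ k x).convMul_apply]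
    have := congrArg (y * ·) (sum_antipodeInv_right_mul_left (k := k) x)
    simpa [ρ, ρ', mulRightAntipodeInv_apply, mul_assoc, Finset.mul_sum, Algebra.algebraMap_eq_smul_one] using this
  have hρ'ρ : toConv ρ' * toConv ρ = 1 := by
    ext x y
    rw [(ℛ k x).convMul_apply]
    have := congrArg (y * ·) (sum_right_mul_antipodeInv_left (k := k) x)
    simpa [ρ, ρ', mulRightAntipodeInv_apply, mul_assoc, Finset.mul_sum, Algebra.algebraMap_eq_smul_one] using this
  have c1 : toConv (A1.toLinearMap ∘ₗ ρ') * toConv (A1.toLinearMap ∘ₗ ρ) = 1 := by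
    rw [← algHom_conv_one A1, ← hρ'ρ, algHom_conv]
  have c2 : toConv (A2.toLinearMap ∘ₗ ρ') * toConv (A2.toLinearMap ∘ₗ ρ) = 1 := by
    rw [← algHom_conv_one A2, ← hρ'ρ, algHom_conv]
  have c3 : toConv (A2.toLinearMap ∘ₗ ρ) * toConv (A2.toLinearMap ∘ₗ ρ') = 1 := by
    rw [← algHom_conv_one A2, ← hρρ', algHom_conv]
  have hp' : toConv p' = toConv (A1.toLinearMap ∘ₗ ρ) * toConv (A2.toLinearMap ∘ₗ ρ) := by
    ext x y z
    simp [(ℛ k x).convMul_apply, p', hA1, hA2, ρ]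
    rw [← (ℛ k x).eq]
    simp [Finset.mul_sum]
  have hLd : toConv Ld = toConv (A1.toLinearMap ∘ₗ lam) * toConv (A2.toLinearMap ∘ₗ lam) := by
    ext x y z
    simp [(ℛ k x).convMul_apply, Ld, hA1, hA2, lam]
    rw [← (ℛ k x).eq]
    simp [Finset.sum_mul]
  have hp'q : toConv p' * toConv q = 1 := by
    ext x : 2
    refine LinearMap.ext fun y => ?_
    rw [(ℛ k x).convMul_apply]
    have := congrArg (fun z => y * comul z) (sum_antipodeInv_right_mul_left (k := k) x)
    simpa [p', q, mul_assoc, Finset.mul_sum, Algebra.algebraMap_eq_smul_one] using this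
  have hq : toConv q = toConv (A2.toLinearMap ∘ₗ ρ') * toConv (A1.toLinearMap ∘ₗ ρ') := by
    symm
    refine left_inv_eq_right_inv (a := toConv p') ?_ hp'q
    rw [hp', mul_assoc, ← mul_assoc _ _ (toConv (A2.toLinearMap ∘ₗ ρ)), c1, one_mul, c2]
  have hact (B : Module.End k H →ₐ[k] Module.End k (H ⊗[k] H)) : toConv (B.toLinearMap ∘ₗ (betaAct β).toLinearMap) =
      toConv (B.toLinearMap ∘ₗ ρ') * (toConv b * toConv (B.toLinearMap ∘ₗ lam)) := by
    have h1 : (betaAct β).toLinearMap = (toConv ρ' * (toConv ((Algebra.ofId k (Module.End k H)).comp β).toLinearMap * toConv lam)).ofConv := by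
      have e1 : toConv (betaMulLeft β).toLinearMap = _ := toConv_algConv _ _ _
      have e2 : toConv (betaAct β).toLinearMap = _ := toConv_algConv _ _ _
      rw [e1] at e2
      exact congrArg WithConv.ofConv e2
    rw [h1, algHom_conv, algHom_conv]
    congr 2
    ext x : 2
    simp [b, Algebra.ofId_apply]
  have hL : ∑ i ∈ (ℛ k h).index, TensorProduct.map (betaAct β ((ℛ k h).left i))
        (LinearMap.mulLeft k ((ℛ k h).right i)) (comul a) =
      (toConv (A1.toLinearMap ∘ₗ (betaAct β).toLinearMap) *
        toConv (A2.toLinearMap ∘ₗ lam)).ofConv h (comul a) := by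
    rw [(ℛ k h).convMul_apply, LinearMap.sum_apply]
    refine Finset.sum_congr rfl fun i _ => ?_
    generalize (comul a : H ⊗[k] H) = u
    induction u with
    | zero => simp
    | tmul x y => simp [hA1, hA2, lam]
    | add x y hx hy => rw [map_add, map_add, hx, hy]
  have hQ (x : H) : comul (betaAct β x a) = (toConv q * (toConv b * toConv Ld)).ofConv x (comul a) := by
    rw [betaAct_apply]
    simp [(ℛ k _).convMul_apply, q, b, Ld, Algebra.ofId_apply, Finset.sum_mul]
  have hR : ∑ i ∈ (ℛ k h).index, (LinearMap.mulRight k ((ℛ k h).left i)).lTensor H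
        (comul (betaAct β ((ℛ k h).right i) a)) =
      (toConv (A2.toLinearMap ∘ₗ ρ) * (toConv q * (toConv b * toConv Ld))).ofConv h (comul a) := by
    simp_rw [hQ]
    rw [(ℛ k h).convMul_apply, LinearMap.sum_apply]
    rfl
  rw [hL, hR, hact, hq, hLd]
  simp only [← mul_assoc]
  rw [c3, one_mul]

/-- The Yetter-Drinfel'd module `H_β = (H, ·_β, Δ)`. -/
noncomputable def regular (β : H →ₐ[k] k) : YetterDrinfeldModule k H H where
  act := betaAct β
  coact := comul
  coact_coassoc := coassoc
  coact_counit := lTensor_counit_comp_comul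
  compat := regular_compat β
end
end HopfAux

namespace YetterDrinfeldModule
open HopfAux

section
variable {k H V W : Type*} [Field k] [Ring H] [Bialgebra k H]
  [AddCommGroup V] [Module k V] [AddCommGroup W] [Module k W]

/-- `h · (m ⊗ n) = ∑ h₁ · m ⊗ h₂ · n`; see `tensorAct_apply`. -/
noncomputable def tensorAct (M : YetterDrinfeldModule k H V) (N : YetterDrinfeldModule k H W) :
    H →ₐ[k] Module.End k (V ⊗[k] W) :=
  (Module.endTensorEndAlgHom.comp (Algebra.TensorProduct.map M.act N.act)).comp
    (Bialgebra.comulAlgHom k H)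

theorem tensorAct_apply (M : YetterDrinfeldModule k H V) (N : YetterDrinfeldModule k H W) (h : H) :
    tensorAct M N h = ∑ i ∈ (ℛ k h).index,
      TensorProduct.map (M.act ((ℛ k h).left i)) (N.act ((ℛ k h).right i)) := by
  simp only [tensorAct, AlgHom.comp_apply, Bialgebra.comulAlgHom_apply]
  rw [← (ℛ k h).eq, map_sum, map_sum]
  rfl

variable (k H V W) in
/-- `(v ⊗ a) ⊗ (w ⊗ c) ↦ (v ⊗ w) ⊗ c a`. -/
noncomputable def shuffle : (V ⊗[k] H) ⊗[k] (W ⊗[k] H) →ₗ[k] (V ⊗[k] W) ⊗[k] H :=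
  (LinearMap.mul' k H ∘ₗ (TensorProduct.comm k H H).toLinearMap).lTensor (V ⊗[k] W) ∘ₗ
    (TensorProduct.tensorTensorTensorComm k V H W H).toLinearMap

@[simp] theorem shuffle_tmul (v : V) (a : H) (w : W) (c : H) :
    shuffle k H V W ((v ⊗ₜ a) ⊗ₜ (w ⊗ₜ c)) = (v ⊗ₜ w) ⊗ₜ (c * a) := rfl

/-- `δ(m ⊗ n) = ∑ m₀ ⊗ n₀ ⊗ n₁ m₁`. -/
noncomputable def tensorCoact (M : YetterDrinfeldModule k H V) (N : YetterDrinfeldModule k H W) :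
    V ⊗[k] W →ₗ[k] (V ⊗[k] W) ⊗[k] H :=
  shuffle k H V W ∘ₗ TensorProduct.map M.coact N.coact

@[simp] theorem tensorCoact_tmul (M : YetterDrinfeldModule k H V) (N : YetterDrinfeldModule k H W)
    (m : V) (n : W) : tensorCoact M N (m ⊗ₜ n) = shuffle k H V W (M.coact m ⊗ₜ N.coact n) := rfl

theorem tensor_coassoc (M : YetterDrinfeldModule k H V) (N : YetterDrinfeldModule k H W) :
    TensorProduct.assoc k (V ⊗[k] W) H H ∘ₗ (tensorCoact M N).rTensor H ∘ₗ tensorCoact M N =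
    (comul (R := k) (A := H)).lTensor (V ⊗[k] W) ∘ₗ tensorCoact M N := by
  let Ψ : (V ⊗[k] (H ⊗[k] H)) ⊗[k] (W ⊗[k] (H ⊗[k] H)) →ₗ[k] (V ⊗[k] W) ⊗[k] (H ⊗[k] H) :=
    shuffle k (H ⊗[k] H) V W
  have h1 : TensorProduct.assoc k (V ⊗[k] W) H H ∘ₗ (tensorCoact M N).rTensor H ∘ₗ
      shuffle k H V W = Ψ ∘ₗ TensorProduct.map
        (TensorProduct.assoc k V H H ∘ₗ M.coact.rTensor H)
        (TensorProduct.assoc k W H H ∘ₗ N.coact.rTensor H) := by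
    ext v a w c
    simp only [TensorProduct.AlgebraTensorModule.curry_apply, LinearMap.restrictScalars_self,
      TensorProduct.curry_apply, LinearMap.comp_apply, shuffle_tmul, LinearMap.rTensor_tmul,
      tensorCoact_tmul, TensorProduct.map_tmul, LinearEquiv.coe_coe]
    generalize M.coact v = x
    generalize N.coact w = y
    induction x with
    | zero => simp
    | add x x' hx hx' => simp only [TensorProduct.add_tmul, map_add, hx, hx']
    | tmul x x' =>
      induction y with
      | zero => simp
      | add y y' hy hy' => simp only [TensorProduct.add_tmul, TensorProduct.tmul_add, map_add, hy, hy']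
      | tmul y y' => simp [Ψ]
  have h2 : (comul (R := k) (A := H)).lTensor (V ⊗[k] W) ∘ₗ shuffle k H V W =
      Ψ ∘ₗ TensorProduct.map ((comul (R := k) (A := H)).lTensor V)
        ((comul (R := k) (A := H)).lTensor W) := by
    ext v a w c
    simp [Ψ]
  ext m n
  have e1 := LinearMap.congr_fun h1 (M.coact m ⊗ₜ N.coact n)
  have e2 := LinearMap.congr_fun h2 (M.coact m ⊗ₜ N.coact n)
  have e3 := LinearMap.congr_fun M.coact_coassoc m
  have e4 := LinearMap.congr_fun N.coact_coassoc n
  simp only [LinearMap.comp_apply, TensorProduct.map_tmul] at e1 e2 e3 e4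
  simp only [TensorProduct.AlgebraTensorModule.curry_apply, LinearMap.restrictScalars_self,
      TensorProduct.curry_apply, LinearMap.comp_apply, tensorCoact_tmul]
  rw [e1, e2, e3, e4]

theorem tensor_counit (M : YetterDrinfeldModule k H V) (N : YetterDrinfeldModule k H W) :
    (counit (R := k) (A := H)).lTensor (V ⊗[k] W) ∘ₗ tensorCoact M N =
      (TensorProduct.mk k (V ⊗[k] W) k).flip 1 := by
  have h2 : (counit (R := k) (A := H)).lTensor (V ⊗[k] W) ∘ₗ shuffle k H V W =
      shuffle k k V W ∘ₗ TensorProduct.map ((counit (R := k) (A := H)).lTensor V)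
        ((counit (R := k) (A := H)).lTensor W) := by
    ext v a w c
    simp
  ext m n
  have e2 := LinearMap.congr_fun h2 (M.coact m ⊗ₜ N.coact n)
  have e3 := LinearMap.congr_fun M.coact_counit m
  have e4 := LinearMap.congr_fun N.coact_counit n
  simp only [LinearMap.comp_apply, TensorProduct.map_tmul] at e2 e3 e4
  simp only [TensorProduct.AlgebraTensorModule.curry_apply, LinearMap.restrictScalars_self,
      TensorProduct.curry_apply, LinearMap.comp_apply, tensorCoact_tmul]
  rw [e2, e3, e4]
  simp

theorem map_sum_left {ι X X' Y Y' : Type*} [AddCommGroup X] [Module k X] [AddCommGroup Y]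
    [Module k Y] [AddCommGroup X'] [Module k X'] [AddCommGroup Y'] [Module k Y']
    (s : Finset ι) (f : ι → X →ₗ[k] X') (g : Y →ₗ[k] Y') :
    TensorProduct.map (∑ i ∈ s, f i) g = ∑ i ∈ s, TensorProduct.map (f i) g := by
  ext
  simp [TensorProduct.sum_tmul]

theorem tensor_compat (M : YetterDrinfeldModule k H V) (N : YetterDrinfeldModule k H W)
    (h : H) (x : V ⊗[k] W) :
    ∑ i ∈ (ℛ k h).index, TensorProduct.map (tensorAct M N ((ℛ k h).left i))
        (LinearMap.mulLeft k ((ℛ k h).right i)) (tensorCoact M N x) =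
      ∑ i ∈ (ℛ k h).index, (LinearMap.mulRight k ((ℛ k h).left i)).lTensor (V ⊗[k] W)
        (tensorCoact M N (tensorAct M N ((ℛ k h).right i) x)) := by
  have s1 (a : H) (u : V ⊗[k] H) (w : W ⊗[k] H) :
      (LinearMap.mulRight k a).lTensor (V ⊗[k] W) (shuffle k H V W (u ⊗ₜ w)) =
        shuffle k H V W ((LinearMap.mulRight k a).lTensor V u ⊗ₜ w) := by
    induction u with
    | zero => simp
    | add x x' hx hx' => simp only [TensorProduct.add_tmul, map_add, hx, hx']
    | tmul x x' =>
      induction w with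
      | zero => simp
      | add y y' hy hy' => simp only [TensorProduct.tmul_add, map_add, hy, hy']
      | tmul y y' => simp [mul_assoc]
  have s2 (f : Module.End k V) (a : H) (u : V ⊗[k] H) (w : W ⊗[k] H) :
      shuffle k H V W (TensorProduct.map f (LinearMap.mulLeft k a) u ⊗ₜ w) =
        shuffle k H V W (f.rTensor H u ⊗ₜ (LinearMap.mulRight k a).lTensor W w) := by
    induction u with
    | zero => simp
    | add x x' hx hx' => simp only [TensorProduct.add_tmul, map_add, hx, hx']
    | tmul x x' =>
      induction w with
      | zero => simp
      | add y y' hy hy' => simp only [TensorProduct.tmul_add, map_add, hy, hy']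
      | tmul y y' => simp [mul_assoc]
  have s3 (f : Module.End k V) (g : Module.End k W) (a : H) (u : V ⊗[k] H) (w : W ⊗[k] H) :
      TensorProduct.map (TensorProduct.map f g) (LinearMap.mulLeft k a)
        (shuffle k H V W (u ⊗ₜ w)) =
        shuffle k H V W (f.rTensor H u ⊗ₜ TensorProduct.map g (LinearMap.mulLeft k a) w) := by
    induction u with
    | zero => simp
    | add x x' hx hx' => simp only [TensorProduct.add_tmul, map_add, hx, hx']
    | tmul x x' =>
      induction w with
      | zero => simp
      | add y y' hy hy' => simp only [TensorProduct.tmul_add, map_add, hy, hy']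
      | tmul y y' => simp [mul_assoc]
  have r1 (a a' : H) : LinearMap.mulRight k (a + a') =
      LinearMap.mulRight k a + LinearMap.mulRight k a' := by ext; simp [mul_add]
  have r2 (t : k) (a : H) : LinearMap.mulRight k (t • a) = t • LinearMap.mulRight k a := by
    ext; simp
  have l1 (a a' : H) : LinearMap.mulLeft k (a + a') =
      LinearMap.mulLeft k a + LinearMap.mulLeft k a' := by ext; simp [add_mul]
  have l2 (t : k) (a : H) : LinearMap.mulLeft k (t • a) = t • LinearMap.mulLeft k a := by
    ext; simp
  induction x with
  | zero => simp
  | add x y hx hy => simp only [map_add, Finset.sum_add_distrib, hx, hy]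
  | tmul m n =>
    have c1 := sum_coassoc (mk₃ (k := k) (X := H) (Y := H) (Z := H) (fun a b c =>
      (LinearMap.mulRight k a).lTensor (V ⊗[k] W)
        (shuffle k H V W (M.coact (M.act b m) ⊗ₜ N.coact (N.act c n))))
      (by simp [r1, l1, TensorProduct.map_add_left, TensorProduct.map_add_right, TensorProduct.add_tmul, TensorProduct.tmul_add, LinearMap.lTensor_add])
      (by simp [r2, l2, TensorProduct.map_smul_left, TensorProduct.map_smul_right, ← TensorProduct.smul_tmul', TensorProduct.tmul_smul, LinearMap.lTensor_smul])
      (by simp [r1, l1, TensorProduct.map_add_left, TensorProduct.map_add_right, TensorProduct.add_tmul, TensorProduct.tmul_add, LinearMap.lTensor_add])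
      (by simp [r2, l2, TensorProduct.map_smul_left, TensorProduct.map_smul_right, ← TensorProduct.smul_tmul', TensorProduct.tmul_smul, LinearMap.lTensor_smul])
      (by simp [r1, l1, TensorProduct.map_add_left, TensorProduct.map_add_right, TensorProduct.add_tmul, TensorProduct.tmul_add, LinearMap.lTensor_add])
      (by simp [r2, l2, TensorProduct.map_smul_left, TensorProduct.map_smul_right, ← TensorProduct.smul_tmul', TensorProduct.tmul_smul, LinearMap.lTensor_smul])) h
    have c2 := sum_coassoc (mk₃ (k := k) (X := H) (Y := H) (Z := H) (fun a b c =>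
      shuffle k H V W (TensorProduct.map (M.act a) (LinearMap.mulLeft k b) (M.coact m) ⊗ₜ
        N.coact (N.act c n)))
      (by simp [r1, l1, TensorProduct.map_add_left, TensorProduct.map_add_right, TensorProduct.add_tmul, TensorProduct.tmul_add, LinearMap.lTensor_add])
      (by simp [r2, l2, TensorProduct.map_smul_left, TensorProduct.map_smul_right, ← TensorProduct.smul_tmul', TensorProduct.tmul_smul, LinearMap.lTensor_smul])
      (by simp [r1, l1, TensorProduct.map_add_left, TensorProduct.map_add_right, TensorProduct.add_tmul, TensorProduct.tmul_add, LinearMap.lTensor_add])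
      (by simp [r2, l2, TensorProduct.map_smul_left, TensorProduct.map_smul_right, ← TensorProduct.smul_tmul', TensorProduct.tmul_smul, LinearMap.lTensor_smul])
      (by simp [r1, l1, TensorProduct.map_add_left, TensorProduct.map_add_right, TensorProduct.add_tmul, TensorProduct.tmul_add, LinearMap.lTensor_add])
      (by simp [r2, l2, TensorProduct.map_smul_left, TensorProduct.map_smul_right, ← TensorProduct.smul_tmul', TensorProduct.tmul_smul, LinearMap.lTensor_smul])) h
    have c3 := sum_coassoc (mk₃ (k := k) (X := H) (Y := H) (Z := H) (fun a b c =>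
      TensorProduct.map (TensorProduct.map (M.act a) (N.act b)) (LinearMap.mulLeft k c)
        (shuffle k H V W (M.coact m ⊗ₜ N.coact n)))
      (by simp [r1, l1, TensorProduct.map_add_left, TensorProduct.map_add_right, TensorProduct.add_tmul, TensorProduct.tmul_add, LinearMap.lTensor_add])
      (by simp [r2, l2, TensorProduct.map_smul_left, TensorProduct.map_smul_right, ← TensorProduct.smul_tmul', TensorProduct.tmul_smul, LinearMap.lTensor_smul])
      (by simp [r1, l1, TensorProduct.map_add_left, TensorProduct.map_add_right, TensorProduct.add_tmul, TensorProduct.tmul_add, LinearMap.lTensor_add])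
      (by simp [r2, l2, TensorProduct.map_smul_left, TensorProduct.map_smul_right, ← TensorProduct.smul_tmul', TensorProduct.tmul_smul, LinearMap.lTensor_smul])
      (by simp [r1, l1, TensorProduct.map_add_left, TensorProduct.map_add_right, TensorProduct.add_tmul, TensorProduct.tmul_add, LinearMap.lTensor_add])
      (by simp [r2, l2, TensorProduct.map_smul_left, TensorProduct.map_smul_right, ← TensorProduct.smul_tmul', TensorProduct.tmul_smul, LinearMap.lTensor_smul])) h
    simp only [mk₃, LinearMap.coe_mk, AddHom.coe_mk, LinearMap.mk₂_apply] at c1 c2 c3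
    have hL : ∀ i, TensorProduct.map (tensorAct M N ((ℛ k h).left i))
        (LinearMap.mulLeft k ((ℛ k h).right i)) (tensorCoact M N (m ⊗ₜ n)) =
        ∑ j ∈ (ℛ k ((ℛ k h).left i)).index,
          TensorProduct.map (TensorProduct.map (M.act ((ℛ k ((ℛ k h).left i)).left j))
            (N.act ((ℛ k ((ℛ k h).left i)).right j))) (LinearMap.mulLeft k ((ℛ k h).right i))
        (shuffle k H V W (M.coact m ⊗ₜ N.coact n)) := by
      intro i
      rw [tensorAct_apply, tensorCoact_tmul, map_sum_left]
      simp
    have hR : ∀ i, (LinearMap.mulRight k ((ℛ k h).left i)).lTensor (V ⊗[k] W)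
        (tensorCoact M N (tensorAct M N ((ℛ k h).right i) (m ⊗ₜ n))) =
        ∑ j ∈ (ℛ k ((ℛ k h).right i)).index, (LinearMap.mulRight k ((ℛ k h).left i)).lTensor (V ⊗[k] W)
        (shuffle k H V W (M.coact (M.act ((ℛ k ((ℛ k h).right i)).left j) m) ⊗ₜ
          N.coact (N.act ((ℛ k ((ℛ k h).right i)).right j) n))) := by
      intro i
      rw [tensorAct_apply]
      simp
    simp_rw [hL, hR]
    rw [← c1, c3]
    simp_rw [s1, ← map_sum, ← TensorProduct.sum_tmul, ← M.compat, TensorProduct.sum_tmul, map_sum]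
    rw [c2]
    simp_rw [s2, s3, ← map_sum, ← TensorProduct.tmul_sum, ← N.compat]

/-- The tensor product of two Yetter-Drinfel'd modules. -/
noncomputable def tensor (M : YetterDrinfeldModule k H V) (N : YetterDrinfeldModule k H W) :
    YetterDrinfeldModule k H (V ⊗[k] W) where
  act := tensorAct M N
  coact := tensorCoact M N
  coact_coassoc := tensor_coassoc M N
  coact_counit := tensor_counit M N
  compat := tensor_compat M N

end
end YetterDrinfeldModule

namespace YetterDrinfeldModule
open HopfAux

section
variable {k H V W : Type*} [Field k] [Ring H] [Bialgebra k H]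
  [AddCommGroup V] [Module k V] [AddCommGroup W] [Module k W]

/-- `N` is a Yetter-Drinfel'd submodule of `M`: `H · N ⊆ N` and `δ(N) ⊆ N ⊗ H`. -/
structure IsSubmodule (M : YetterDrinfeldModule k H V) (N : Submodule k V) : Prop where
  act_mem : ∀ (h : H), ∀ v ∈ N, M.act h v ∈ N
  coact_mem : ∀ v ∈ N, M.coact v ∈ LinearMap.range (N.subtype.rTensor H)

/-- `M` is a simple Yetter-Drinfel'd module: it is nonzero and has no submodules besides `0` and `M`. -/
structure IsSimple (M : YetterDrinfeldModule k H V) : Prop where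
  nontrivial : Nontrivial V
  eq_bot_or_eq_top : ∀ N : Submodule k V, M.IsSubmodule N → N = ⊥ ∨ N = ⊤

/-- An isomorphism of Yetter-Drinfel'd modules: a linear bijection commuting with the actions and
the coactions. -/
structure Iso (M : YetterDrinfeldModule k H V) (N : YetterDrinfeldModule k H W) extends
    V ≃ₗ[k] W where
  map_act : ∀ (h : H) (v : V), toLinearEquiv (M.act h v) = N.act h (toLinearEquiv v)
  map_coact : ∀ v : V,
    N.coact (toLinearEquiv v) = toLinearEquiv.toLinearMap.rTensor H (M.coact v)

theorem subtype_rTensor_injective (N : Submodule k V) (X : Type*) [AddCommGroup X] [Module k X] :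
    Function.Injective (N.subtype.rTensor X) :=
  Module.Flat.rTensor_preserves_injective_linearMap _ N.injective_subtype

namespace IsSubmodule
variable {M : YetterDrinfeldModule k H V} {N : Submodule k V}

/-- The action on a Yetter-Drinfel'd submodule. -/
noncomputable def act (hN : M.IsSubmodule N) : H →ₐ[k] Module.End k N :=
  AlgHom.ofLinearMap
    { toFun := fun h => (M.act h).restrict (hN.act_mem h)
      map_add' := fun _ _ => by ext; simp
      map_smul' := fun _ _ => by ext; simp }
    (by ext; simp) (fun _ _ => by ext; simp)

theorem coe_act (hN : M.IsSubmodule N) (h : H) (v : N) : (hN.act h v : V) = M.act h v := rfl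

/-- The coaction on a Yetter-Drinfel'd submodule: `δ` restricted to `N → N ⊗ H`. -/
noncomputable def coact (hN : M.IsSubmodule N) : N →ₗ[k] N ⊗[k] H :=
  (LinearEquiv.ofInjective _ (subtype_rTensor_injective N H)).symm.toLinearMap ∘ₗ
    (M.coact ∘ₗ N.subtype).codRestrict _ (fun v => hN.coact_mem v v.2)

theorem rTensor_coact (hN : M.IsSubmodule N) (v : N) :
    N.subtype.rTensor H (hN.coact v) = M.coact v := by
  have := (LinearEquiv.ofInjective _ (subtype_rTensor_injective N H)).apply_symm_apply
    ((M.coact ∘ₗ N.subtype).codRestrict _ (fun v => hN.coact_mem v v.2) v)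
  exact congrArg Subtype.val this

end IsSubmodule

/-- A Yetter-Drinfel'd submodule, as a Yetter-Drinfel'd module. -/
noncomputable def restrict (M : YetterDrinfeldModule k H V) (N : Submodule k V)
    (hN : M.IsSubmodule N) : YetterDrinfeldModule k H N where
  act := hN.act
  coact := hN.coact
  coact_coassoc := by
    ext v
    apply subtype_rTensor_injective N (H ⊗[k] H)
    have e1 : N.subtype.rTensor (H ⊗[k] H) ∘ₗ (TensorProduct.assoc k N H H).toLinearMap =
        (TensorProduct.assoc k V H H).toLinearMap ∘ₗ (N.subtype.rTensor H).rTensor H := by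
      ext; simp
    have e2 : (N.subtype.rTensor H).rTensor H ∘ₗ hN.coact.rTensor H =
        M.coact.rTensor H ∘ₗ N.subtype.rTensor H := by
      rw [← LinearMap.rTensor_comp, ← LinearMap.rTensor_comp]
      congr 1
      ext v
      exact hN.rTensor_coact v
    have e3 : N.subtype.rTensor (H ⊗[k] H) ∘ₗ (comul (R := k) (A := H)).lTensor N =
        (comul (R := k) (A := H)).lTensor V ∘ₗ N.subtype.rTensor H := by
      ext; simp
    have e4 := LinearMap.congr_fun M.coact_coassoc v
    have e1 := LinearMap.congr_fun e1 (hN.coact.rTensor H (hN.coact v))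
    have e2 := LinearMap.congr_fun e2 (hN.coact v)
    have e3 := LinearMap.congr_fun e3 (hN.coact v)
    simp only [LinearMap.comp_apply, LinearEquiv.coe_coe, hN.rTensor_coact] at e1 e2 e3 e4 ⊢
    rw [e1, e2, e3, e4]
  coact_counit := by
    ext v
    apply subtype_rTensor_injective N k
    have e3 : N.subtype.rTensor k ∘ₗ (counit (R := k) (A := H)).lTensor N =
        (counit (R := k) (A := H)).lTensor V ∘ₗ N.subtype.rTensor H := by
      ext; simp
    have e4 := LinearMap.congr_fun M.coact_counit v
    have e3 := LinearMap.congr_fun e3 (hN.coact v)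
    simp only [LinearMap.comp_apply, LinearEquiv.coe_coe, hN.rTensor_coact] at e3 e4 ⊢
    rw [e3, e4]
    simp
  compat h v := by
    apply subtype_rTensor_injective N H
    have e1 (f : Module.End k H) (a : H) : N.subtype.rTensor H ∘ₗ TensorProduct.map (hN.act a) f =
        TensorProduct.map (M.act a) f ∘ₗ N.subtype.rTensor H := by
      ext; simp [hN.coe_act]
    have e2 (f : Module.End k H) : N.subtype.rTensor H ∘ₗ f.lTensor N =
        f.lTensor V ∘ₗ N.subtype.rTensor H := by
      ext; simp
    have e1 (f a) := LinearMap.congr_fun (e1 f a) (hN.coact v)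
    have e2 (f x) := LinearMap.congr_fun (e2 f) x
    simp only [LinearMap.comp_apply, hN.rTensor_coact] at e1 e2
    simp only [map_sum, e1, e2, hN.rTensor_coact, hN.coe_act, M.compat]

end

section
variable {k H : Type*} [Field k] [Ring H] [HopfAlgebra k H] [FiniteDimensional k H]

/-- `H ·_β g = {h ·_β g : h ∈ H}`, a subspace of `H`. -/
noncomputable def orbit (β : H →ₐ[k] k) (g : H) : Submodule k H :=
  LinearMap.range ((regular β).act.toLinearMap.flip g)

theorem mem_orbit (β : H →ₐ[k] k) (g x : H) :
    x ∈ orbit β g ↔ ∃ h, (regular β).act h g = x := Iff.rfl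

theorem coact_act {V : Type*} [AddCommGroup V] [Module k V] (M : YetterDrinfeldModule k H V)
    (h : H) (m : V) : M.coact (M.act h m) =
      ∑ i ∈ (ℛ k h).index, ∑ j ∈ (ℛ k ((ℛ k h).right i)).index,
        (LinearMap.mulRight k (antipodeInv k ((ℛ k h).left i))).lTensor V
          (TensorProduct.map (M.act ((ℛ k ((ℛ k h).right i)).left j))
            (LinearMap.mulLeft k ((ℛ k ((ℛ k h).right i)).right j)) (M.coact m)) := by
  have r1 (a a' : H) : LinearMap.mulRight k (a + a') =
      LinearMap.mulRight k a + LinearMap.mulRight k a' := by ext; simp [mul_add]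
  have r2 (t : k) (a : H) : LinearMap.mulRight k (t • a) = t • LinearMap.mulRight k a := by
    ext; simp
  have r3 (a b : H) (x : V ⊗[k] H) : (LinearMap.mulRight k a).lTensor V
      ((LinearMap.mulRight k b).lTensor V x) = (LinearMap.mulRight k (b * a)).lTensor V x := by
    rw [LinearMap.mulRight_mul, LinearMap.lTensor_comp]; rfl
  simp_rw [← map_sum, M.compat, map_sum, r3]
  have := sum_coassoc (mk₃ (k := k) (X := H) (Y := H) (Z := H) (fun a b c =>
      (LinearMap.mulRight k (b * antipodeInv k a)).lTensor V (M.coact (M.act c m)))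
      (by simp [r1, mul_add, LinearMap.lTensor_add])
      (by simp [r2, LinearMap.lTensor_smul])
      (by simp [r1, add_mul, LinearMap.lTensor_add])
      (by simp [r2, LinearMap.lTensor_smul])
      (by simp)
      (by simp)) h
  simp only [mk₃, LinearMap.coe_mk, AddHom.coe_mk, LinearMap.mk₂_apply] at this
  rw [← this]
  have r4 (x : H) (y : V ⊗[k] H) : ∑ j ∈ (ℛ k x).index,
      (LinearMap.mulRight k ((ℛ k x).right j * antipodeInv k ((ℛ k x).left j))).lTensor V y =
      counit (R := k) x • y := by
    induction y with
    | zero => simp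
    | add y y' hy hy' => simp only [map_add, Finset.sum_add_distrib, hy, hy', smul_add]
    | tmul v b =>
      simp only [LinearMap.lTensor_tmul, LinearMap.mulRight_apply, ← TensorProduct.tmul_sum,
        ← Finset.mul_sum, sum_right_mul_antipodeInv_left]
      simp
  simp_rw [r4]
  conv_lhs => rw [← sum_counit_smul (ℛ k h)]
  simp

theorem isSubmodule_orbit (β : H →ₐ[k] k) (g : GroupLike k H) :
    (regular β).IsSubmodule (orbit β (g : H)) where
  act_mem := by
    rintro h _ ⟨x, rfl⟩
    exact ⟨h * x, by simp⟩
  coact_mem := by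
    rintro _ ⟨h, rfl⟩
    have : (regular β).act.toLinearMap.flip (g : H) h = (regular β).act h g := rfl
    rw [this, coact_act]
    refine Submodule.sum_mem _ fun i _ => Submodule.sum_mem _ fun j _ => ?_
    have : (regular β).coact (g : H) = (g : H) ⊗ₜ[k] (g : H) := g.isGroupLikeElem_val.comul_eq_tmul_self
    rw [this, TensorProduct.map_tmul, LinearMap.lTensor_tmul]
    exact ⟨(⟨_, ⟨_, rfl⟩⟩ : orbit β (g : H)) ⊗ₜ _, rfl⟩

/-- For `β ∈ G(H^*)`, that is an algebra map `H → k`, and `g ∈ G(H)`: the Yetter-Drinfel'd module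
`H ·_β g`, a submodule of `H_β`. `WithConv` equips the algebra maps with the convolution product. -/
noncomputable def radfordModule (β : WithConv (H →ₐ[k] k)) (g : GroupLike k H) :
    YetterDrinfeldModule k H (orbit β.ofConv (g : H)) :=
  (regular β.ofConv).restrict _ (isSubmodule_orbit β.ofConv g)
end
end YetterDrinfeldModule

/-- The algebra grading `H = ⨁ 𝒜 n` is a grading of Hopf algebras:
`Δ(𝒜 n) ⊆ ∑_{i+j=n} 𝒜 i ⊗ 𝒜 j`, `ε(𝒜 n) = 0` for `n ≠ 0` and `S(𝒜 n) ⊆ 𝒜 n`. -/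
structure IsGradedHopfAlgebra {k H : Type*} [Field k] [Ring H] [HopfAlgebra k H]
    (𝒜 : ℕ → Submodule k H) [GradedAlgebra 𝒜] : Prop where
  comul_mem : ∀ n, ∀ x ∈ 𝒜 n, comul (R := k) x ∈
    ⨆ (p : ℕ × ℕ) (_ : p.1 + p.2 = n), LinearMap.range (TensorProduct.mapIncl (𝒜 p.1) (𝒜 p.2))
  counit_eq_zero : ∀ n, n ≠ 0 → ∀ x ∈ 𝒜 n, counit (R := k) x = 0
  antipode_mem : ∀ n, ∀ x ∈ 𝒜 n, antipode k x ∈ 𝒜 n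

end

/-! The isomorphism is induced by the reversed multiplication `a ⊗ b ↦ b a`, which is a morphism of
Yetter-Drinfel'd modules `H_β ⊗ H_β' → H_{ββ'}` for any two `β`, `β'` (`isHom_mul`). It respects
coactions because `Δ` is multiplicative and the tensor coaction carries the factor `n₁m₁` in the
same reversed order. It respects actions because of a cancellation. In Sweedler notation the image
of `h · (a ⊗ b)` is `∑ β'(h₅) h₆ b S⁻¹(h₄) β(h₂) h₃ a S⁻¹(h₁)`, and the inner product `S⁻¹(h₄) h₃`
collapses to a counit, leaving `∑ β(h₂)β'(h₃) h₄ (b a) S⁻¹(h₁)`, the action of `h` on `b a` in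
`H_{ββ'}`.

Restrict this morphism to the tensor product of the two orbits. The vector `g ⊗ g'` goes to `g'g`,
which is group-like and hence nonzero. If the tensor product is simple, the kernel is therefore
zero. Moreover `g ⊗ g'` generates the tensor product: its coaction has the form `v ↦ v ⊗ c`, so the
`H`-submodule it generates is already a Yetter-Drinfel'd submodule. The image is then exactly the
orbit of `g'g` (`IsSimple.nonempty_iso`).

It remains to see that `g'g = gg'`. Group-like elements of a graded Hopf algebra live in degree `0`
(`groupLike_mem`), and the degree `0` part is the commutative algebra `kG`. -/

section
open scoped TensorProduct
open Coalgebra HopfAlgebra WithConv HopfAux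

/-! ### Group-like elements of a graded Hopf algebra -/

namespace IsGradedHopfAlgebra
variable {k H : Type*} [Field k] [Ring H] [HopfAlgebra k H]
  {𝒜 : ℕ → Submodule k H} [GradedAlgebra 𝒜]

/-- A summand `𝒜 p ⊗ 𝒜 q` survives both projections only if `(p, q) = (i, j)`, and the summands that
occur in `Δ(𝒜 n)` have `p + q = n`. -/
theorem map_proj_comul_eq_zero (h𝒜 : IsGradedHopfAlgebra 𝒜) {i j n : ℕ} (hn : i + j ≠ n)
    {x : H} (hx : x ∈ 𝒜 n) :
    TensorProduct.map (GradedAlgebra.proj 𝒜 i) (GradedAlgebra.proj 𝒜 j)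
      (comul (R := k) x) = 0 := by
  have hle : (⨆ (p : ℕ × ℕ) (_ : p.1 + p.2 = n),
      LinearMap.range (TensorProduct.mapIncl (𝒜 p.1) (𝒜 p.2))) ≤
      LinearMap.ker (TensorProduct.map (GradedAlgebra.proj 𝒜 i) (GradedAlgebra.proj 𝒜 j)) := by
    refine iSup₂_le fun p hp => ?_
    rw [LinearMap.range_le_ker_iff]
    ext a b
    have hij : p.1 ≠ i ∨ p.2 ≠ j := by
      by_contra! hc
      omega
    rcases hij with hij | hij
    · have h0 : GradedAlgebra.proj 𝒜 i a = 0 := DirectSum.decompose_of_mem_ne 𝒜 a.2 hij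
      simp only [TensorProduct.AlgebraTensorModule.curry_apply, LinearMap.restrictScalars_self,
        TensorProduct.curry_apply, LinearMap.comp_apply, TensorProduct.mapIncl,
        TensorProduct.map_tmul, Submodule.subtype_apply, h0, TensorProduct.zero_tmul,
        LinearMap.zero_apply, map_zero]
    · have h0 : GradedAlgebra.proj 𝒜 j b = 0 := DirectSum.decompose_of_mem_ne 𝒜 b.2 hij
      simp only [TensorProduct.AlgebraTensorModule.curry_apply, LinearMap.restrictScalars_self,
        TensorProduct.curry_apply, LinearMap.comp_apply, TensorProduct.mapIncl,
        TensorProduct.map_tmul, Submodule.subtype_apply, h0, TensorProduct.tmul_zero,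
        LinearMap.zero_apply, map_zero]
  exact hle (h𝒜.comul_mem n x hx)

/-- The group-like elements of a graded Hopf algebra have degree `0`. -/
theorem groupLike_mem (h𝒜 : IsGradedHopfAlgebra 𝒜) (g : GroupLike k H) : (g : H) ∈ 𝒜 0 := by
  classical
  set s := (DirectSum.decompose 𝒜 (g : H)).support with hs
  -- The `(n, n)` component of `Δ g = g ⊗ g` is `gₙ ⊗ gₙ`. It can only come from `Δ` of the
  -- component of degree `2n`, so `gₙ ≠ 0` forces `g₂ₙ ≠ 0`.
  have hdouble : ∀ n, n ≠ 0 → n ∈ s → n + n ∈ s := by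
    intro n _ hn
    by_contra hnn
    have h0 : TensorProduct.map (GradedAlgebra.proj 𝒜 n) (GradedAlgebra.proj 𝒜 n)
        (comul (R := k) (g : H)) = 0 := by
      conv_lhs => rw [← DirectSum.sum_support_decompose 𝒜 (g : H)]
      rw [map_sum, map_sum]
      refine Finset.sum_eq_zero fun m hm => ?_
      exact h𝒜.map_proj_comul_eq_zero (fun h => hnn (h ▸ hm)) (SetLike.coe_mem _)
    rw [g.isGroupLikeElem_val.comul_eq_tmul_self, TensorProduct.map_tmul] at h0
    rw [hs, DFinsupp.mem_support_iff] at hn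
    -- If `x ⊗ x = 0`, then `φ(x)² = 0` for every functional `φ`, hence `x = 0`.
    refine hn (Subtype.ext ((Module.forall_dual_apply_eq_zero_iff k _).mp fun φ => ?_))
    have := congrArg (LinearMap.mul' k k ∘ₗ TensorProduct.map φ φ) h0
    rw [LinearMap.comp_apply, TensorProduct.map_tmul, LinearMap.mul'_apply, map_zero] at this
    exact mul_self_eq_zero.mp this
  have hzero : ∀ n ∈ s, n = 0 := by
    intro n hn
    by_contra hn0
    -- The support is finite and closed under doubling, so its largest element cannot be positive.
    have hmax := s.max'_mem ⟨n, hn⟩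
    have hle := s.le_max' n hn
    have := s.le_max' _ (hdouble _ (by omega) hmax)
    omega
  rw [← DirectSum.sum_support_decompose 𝒜 (g : H)]
  exact Submodule.sum_mem _ fun n hn => hzero n hn ▸ SetLike.coe_mem _

end IsGradedHopfAlgebra

namespace YetterDrinfeldModule

/-! ### Morphisms of Yetter-Drinfel'd modules -/

section
variable {k H U V W X : Type*} [Field k] [Ring H] [Bialgebra k H]
  [AddCommGroup U] [Module k U] [AddCommGroup V] [Module k V] [AddCommGroup W] [Module k W]
  [AddCommGroup X] [Module k X]

/-- A linear map commuting with the actions and the coactions. -/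
structure IsHom (M : YetterDrinfeldModule k H V) (N : YetterDrinfeldModule k H W)
    (f : V →ₗ[k] W) : Prop where
  map_act : ∀ (h : H) (v : V), f (M.act h v) = N.act h (f v)
  map_coact : ∀ v : V, N.coact (f v) = f.rTensor H (M.coact v)

namespace IsHom

theorem comp {L : YetterDrinfeldModule k H U} {M : YetterDrinfeldModule k H V}
    {N : YetterDrinfeldModule k H W} {f : V →ₗ[k] W} {e : U →ₗ[k] V}
    (hf : M.IsHom N f) (he : L.IsHom M e) : L.IsHom N (f ∘ₗ e) where
  map_act h v := by simp [he.map_act, hf.map_act]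
  map_coact v := by simp [he.map_coact, hf.map_coact, LinearMap.rTensor_comp]

theorem subtype (M : YetterDrinfeldModule k H V) {N : Submodule k V} (hN : M.IsSubmodule N) :
    (M.restrict N hN).IsHom M N.subtype where
  map_act _ _ := rfl
  map_coact v := (hN.rTensor_coact v).symm

theorem rTensor_map_shuffle (f : V →ₗ[k] W) (e : U →ₗ[k] X) (x : V ⊗[k] H) (y : U ⊗[k] H) :
    (TensorProduct.map f e).rTensor H (shuffle k H V U (x ⊗ₜ y)) =
      shuffle k H W X (f.rTensor H x ⊗ₜ e.rTensor H y) := by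
  induction x with
  | zero => simp
  | add x x' hx hx' => simp only [TensorProduct.add_tmul, map_add, hx, hx']
  | tmul x x' =>
    induction y with
    | zero => simp
    | add y y' hy hy' => simp only [TensorProduct.tmul_add, map_add, hy, hy']
    | tmul y y' => simp

theorem tensor {M : YetterDrinfeldModule k H V} {N : YetterDrinfeldModule k H W}
    {M' : YetterDrinfeldModule k H U} {N' : YetterDrinfeldModule k H X}
    {f : V →ₗ[k] W} {e : U →ₗ[k] X} (hf : M.IsHom N f) (he : M'.IsHom N' e) :
    (M.tensor M').IsHom (N.tensor N') (TensorProduct.map f e) where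
  map_act h v := by
    change TensorProduct.map f e (tensorAct M M' h v) = tensorAct N N' h _
    induction v with
    | zero => simp
    | add v v' hv hv' => simp only [map_add, hv, hv']
    | tmul v u => simp [tensorAct_apply, hf.map_act, he.map_act]
  map_coact v := by
    change tensorCoact N N' _ = (TensorProduct.map f e).rTensor H (tensorCoact M M' v)
    induction v with
    | zero => simp
    | add v v' hv hv' => simp only [map_add, hv, hv']
    | tmul v u => simp [rTensor_map_shuffle, hf.map_coact, he.map_coact]

/-- If `f v = 0`, then `δ(v)` is killed by `f ⊗ H`. Since `H` is flat over the field `k`, the kernel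
of `f ⊗ H` is `ker f ⊗ H`. -/
theorem isSubmodule_ker {M : YetterDrinfeldModule k H V} {N : YetterDrinfeldModule k H W}
    {f : V →ₗ[k] W} (hf : M.IsHom N f) : M.IsSubmodule (LinearMap.ker f) where
  act_mem h v hv := by
    rw [LinearMap.mem_ker] at hv ⊢
    rw [hf.map_act, hv, map_zero]
  coact_mem v hv := by
    rw [LinearMap.mem_ker] at hv
    have hex := Module.Flat.rTensor_exact H (LinearMap.exact_subtype_ker_map f)
    exact (hex (M.coact v)).mp (by rw [← hf.map_coact, hv, map_zero])

end IsHom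
end

/-! ### Morphisms out of simple modules -/

section
variable {k H V W : Type*} [Field k] [Ring H] [HopfAlgebra k H] [FiniteDimensional k H]
  [AddCommGroup V] [Module k V] [AddCommGroup W] [Module k W]

/-- The `H`-submodule generated by a vector `v` with `δ(v) = v ⊗ c` is a Yetter-Drinfel'd
submodule. -/
theorem isSubmodule_range_act (M : YetterDrinfeldModule k H V) {v : V} {c : H}
    (hv : M.coact v = v ⊗ₜ c) : M.IsSubmodule (LinearMap.range (M.act.toLinearMap.flip v)) where
  act_mem := by
    rintro h _ ⟨x, rfl⟩
    exact ⟨h * x, by simp⟩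
  coact_mem := by
    rintro _ ⟨h, rfl⟩
    rw [show M.act.toLinearMap.flip v h = M.act h v from rfl, coact_act]
    refine Submodule.sum_mem _ fun i _ => Submodule.sum_mem _ fun j _ => ?_
    rw [hv, TensorProduct.map_tmul, LinearMap.lTensor_tmul]
    exact ⟨(⟨_, ⟨_, rfl⟩⟩ : LinearMap.range (M.act.toLinearMap.flip v)) ⊗ₜ _, rfl⟩

/-- A morphism out of a simple module that does not kill a vector `v` with `δ(v) = v ⊗ c` is an
isomorphism onto the submodule generated by the image of `v`. -/
theorem IsSimple.nonempty_iso {M : YetterDrinfeldModule k H V} (hM : M.IsSimple)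
    {N : YetterDrinfeldModule k H W} {f : V →ₗ[k] W} (hf : M.IsHom N f) {v : V} {c : H} {w : W}
    (hv : M.coact v = v ⊗ₜ c) (hfv : f v = w) (hw : w ≠ 0)
    (hP : N.IsSubmodule (LinearMap.range (N.act.toLinearMap.flip w))) :
    Nonempty (M.Iso (N.restrict _ hP)) := by
  have hv0 : v ≠ 0 := by
    rintro rfl
    exact hw (hfv ▸ map_zero f)
  -- The submodule generated by `v` contains `v ≠ 0`, so simplicity makes it everything.
  have hgen : LinearMap.range (M.act.toLinearMap.flip v) = ⊤ := by
    refine (hM.eq_bot_or_eq_top _ (M.isSubmodule_range_act hv)).resolve_left fun h => hv0 ?_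
    rw [← Submodule.mem_bot k, ← h]
    exact ⟨1, by simp⟩
  have hker : LinearMap.ker f = ⊥ := by
    refine (hM.eq_bot_or_eq_top _ hf.isSubmodule_ker).resolve_right fun h => hw ?_
    rw [← hfv, ← LinearMap.mem_ker, h]
    exact Submodule.mem_top
  have himage (h : H) : f (M.act h v) = N.act h w := by rw [hf.map_act, hfv]
  have hmem (x : V) : f x ∈ LinearMap.range (N.act.toLinearMap.flip w) := by
    obtain ⟨h, rfl⟩ : x ∈ LinearMap.range (M.act.toLinearMap.flip v) :=
      hgen ▸ Submodule.mem_top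
    exact ⟨h, (himage h).symm⟩
  let F := f.codRestrict _ hmem
  have hF : Function.Bijective F := by
    refine ⟨fun x y hxy => LinearMap.ker_eq_bot.mp hker (congrArg Subtype.val hxy), ?_⟩
    rintro ⟨_, h, rfl⟩
    exact ⟨M.act h v, Subtype.ext (himage h)⟩
  refine ⟨⟨LinearEquiv.ofBijective F hF, fun h x => Subtype.ext (hf.map_act h x), fun x => ?_⟩⟩
  -- The coaction of the submodule is known through its image in `W ⊗ H`, so the two sides are
  -- compared there; the claim becomes compatibility of `f` with the coactions.
  apply subtype_rTensor_injective (LinearMap.range (N.act.toLinearMap.flip w)) H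
  refine ((hP.rTensor_coact _).trans (hf.map_coact x)).trans ?_
  exact LinearMap.congr_fun (LinearMap.rTensor_comp H
    (LinearMap.range (N.act.toLinearMap.flip w)).subtype F) (M.coact x)

/-! ### The regular action as a convolution product, and the reversed multiplication -/

/-- The functional `β`, as a map to `Hᵐᵒᵖ`. -/
noncomputable def convScalar (β : H →ₐ[k] k) : WithConv (H →ₗ[k] Hᵐᵒᵖ) :=
  toConv (Algebra.linearMap k Hᵐᵒᵖ ∘ₗ β.toLinearMap)

variable (k) in
/-- The map `h ↦ ε(h) a`, with values in `Hᵐᵒᵖ`. -/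
noncomputable def convConst (a : H) : WithConv (H →ₗ[k] Hᵐᵒᵖ) :=
  toConv ((counit (R := k) (A := H)).smulRight (MulOpposite.op a))

variable (k H) in
/-- The identity of `H`, as a map to `Hᵐᵒᵖ`. -/
noncomputable def convOp : WithConv (H →ₗ[k] Hᵐᵒᵖ) :=
  toConv (MulOpposite.opLinearEquiv k).toLinearMap

variable (k H) in
/-- The inverse of the antipode, as a map to `Hᵐᵒᵖ`. -/
noncomputable def convOpAntipodeInv : WithConv (H →ₗ[k] Hᵐᵒᵖ) :=
  toConv ((MulOpposite.opLinearEquiv k).toLinearMap ∘ₗ antipodeInv k)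

theorem convConst_mul_apply (a : H) (f : WithConv (H →ₗ[k] Hᵐᵒᵖ)) (h : H) :
    (convConst k a * f) h = MulOpposite.op a * f h := by
  rw [(ℛ k h).convMul_apply]
  conv_rhs => rw [← sum_counit_smul (ℛ k h)]
  simp [convConst, Finset.mul_sum]

theorem mul_convConst_apply (a : H) (f : WithConv (H →ₗ[k] Hᵐᵒᵖ)) (h : H) :
    (f * convConst k a) h = f h * MulOpposite.op a := by
  rw [(ℛ k h).convMul_apply]
  have hh := congrArg (TensorProduct.rid k H) (sum_tmul_counit_eq (ℛ k h))
  simp only [map_sum, TensorProduct.rid_tmul, one_smul] at hh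
  conv_rhs => rw [← hh]
  simp [convConst, Finset.sum_mul]

/-- Both products send `h` to `β(h) a`: scalars are central, and the counit absorbs the other tensor
factor of `Δ h`. -/
theorem convConst_mul_convScalar (a : H) (β : H →ₐ[k] k) :
    convConst k a * convScalar β = convScalar β * convConst k a := by
  ext h
  rw [convConst_mul_apply, mul_convConst_apply]
  exact (Algebra.commutes (β h) (MulOpposite.op a)).symm

theorem convConst_mul_convConst (a b : H) :
    convConst k a * convConst k b = convConst k (b * a) := by
  ext h
  rw [convConst_mul_apply]
  simp [convConst]

/-- The unit map `k → Hᵐᵒᵖ` is an algebra map, and composing with an algebra map preserves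
convolution. -/
theorem convScalar_mul_convScalar (β β' : WithConv (H →ₐ[k] k)) :
    convScalar β.ofConv * convScalar β'.ofConv = convScalar (β * β').ofConv := by
  have := algHom_conv (Algebra.ofId k Hᵐᵒᵖ) (toConv β.ofConv.toLinearMap)
    (toConv β'.ofConv.toLinearMap)
  rw [← AlgHom.toLinearMap_convMul] at this
  exact this.symm

/-- In `Hᵐᵒᵖ` this is the identity `∑ S⁻¹(h₂) h₁ = ε(h)`; it is the cancellation behind `isHom_mul`.
-/
theorem convOp_mul_convOpAntipodeInv : convOp k H * convOpAntipodeInv k H = 1 := by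
  ext h
  rw [(ℛ k h).convMul_apply]
  have := congrArg MulOpposite.op (sum_antipodeInv_right_mul_left (k := k) h)
  simpa [convOp, convOpAntipodeInv, Algebra.algebraMap_eq_smul_one] using this

/-- In `β(h₂) h₃ a S⁻¹(h₁)` the Sweedler indices do not follow the order of the factors. Passing to
`Hᵐᵒᵖ` reverses the factors to `S⁻¹(h₁), β(h₂), a, h₃`, so the action becomes one convolution
product and associativity of convolution replaces manipulation of iterated coproducts. -/
theorem op_regular_act (β : H →ₐ[k] k) (a h : H) :
    MulOpposite.op ((regular β).act h a) =
      (convOpAntipodeInv k H * (convScalar β * (convConst k a * convOp k H))) h := by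
  rw [show (regular β).act h a = _ from betaAct_apply β h a, (ℛ k h).convMul_apply]
  simp only [(ℛ k _).convMul_apply (f := convScalar β), convConst_mul_apply]
  simp [convOp, convOpAntipodeInv, convScalar, Finset.mul_sum, mul_assoc,
    Algebra.algebraMap_eq_smul_one]

/-- `a ⊗ b ↦ b a` is a morphism `H_β ⊗ H_β' → H_{β β'}`. -/
theorem isHom_mul (β β' : WithConv (H →ₐ[k] k)) :
    ((regular β.ofConv).tensor (regular β'.ofConv)).IsHom (regular (β * β').ofConv)
      (LinearMap.mul' k H ∘ₗ (TensorProduct.comm k H H).toLinearMap) where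
  map_act h v := by
    change (LinearMap.mul' k H ∘ₗ (TensorProduct.comm k H H).toLinearMap)
      (tensorAct (regular β.ofConv) (regular β'.ofConv) h v) = _
    induction v with
    | zero => simp
    | add v v' hv hv' => simp only [map_add, hv, hv']
    | tmul a b =>
      apply MulOpposite.op_injective
      -- Since `op (b a) = op a * op b`, applying the reversed multiplication to `h · (a ⊗ b)`
      -- amounts to convolving the two action maps.
      have key : (convOpAntipodeInv k H * (convScalar β.ofConv * (convConst k a * convOp k H))) *
          (convOpAntipodeInv k H * (convScalar β'.ofConv * (convConst k b * convOp k H))) =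
          convOpAntipodeInv k H *
            (convScalar (β * β').ofConv * (convConst k (b * a) * convOp k H)) := by
        rw [← convScalar_mul_convScalar, ← convConst_mul_convConst]
        simp only [mul_assoc]
        congr 2
        -- The inner pair `h₃`, `S⁻¹(h₄)` cancels; then `β'` is moved to the left past the constant
        -- `a` to stand beside `β`.
        rw [← mul_assoc (convOp k H), convOp_mul_convOpAntipodeInv, one_mul,
          ← mul_assoc (convConst k a), convConst_mul_convScalar, mul_assoc]
      have := congrArg (fun f => f h) key
      simp only [(ℛ k h).convMul_apply (f := convOpAntipodeInv k H * (convScalar β.ofConv * (convConst k a * convOp k H))), ← op_regular_act] at this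
      simpa [tensorAct_apply] using this
  map_coact v := by
    change comul _ = LinearMap.rTensor H _
      (tensorCoact (regular β.ofConv) (regular β'.ofConv) v)
    induction v with
    | zero => simp
    | add v v' hv hv' => simp only [map_add, hv, hv']
    | tmul a b =>
      change comul (b * a) = LinearMap.rTensor H _ (shuffle k H H H (comul a ⊗ₜ comul b))
      rw [Bialgebra.comul_mul]
      -- The identity is bilinear in `Δ a` and `Δ b` and holds for arbitrary tensors, so pure
      -- tensors suffice.
      generalize (comul a : H ⊗[k] H) = x
      generalize (comul b : H ⊗[k] H) = y
      induction x with
      | zero => simp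
      | add x x' hx hx' => simp only [TensorProduct.add_tmul, mul_add, map_add, hx, hx']
      | tmul x x' =>
        induction y with
        | zero => simp
        | add y y' hy hy' => simp only [TensorProduct.tmul_add, add_mul, map_add, hy, hy']
        | tmul y y' => simp

/-- This supplies the vectors with `δ(v) = v ⊗ c` that `IsSimple.nonempty_iso` needs; the equality
is checked in `H ⊗ H`, where it says that `g` is group-like. -/
theorem radfordModule_coact_groupLike (β : WithConv (H →ₐ[k] k)) (g : GroupLike k H)
    (v : orbit β.ofConv (g : H)) (hv : (v : H) = g) :
    (radfordModule β g).coact v = v ⊗ₜ (g : H) := by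
  apply subtype_rTensor_injective (orbit β.ofConv (g : H)) H
  refine ((isSubmodule_orbit β.ofConv g).rTensor_coact v).trans ?_
  rw [LinearMap.rTensor_tmul, Submodule.subtype_apply, hv]
  exact g.isGroupLikeElem_val.comul_eq_tmul_self

theorem self_mem_orbit (β : H →ₐ[k] k) (a : H) : a ∈ orbit β a :=
  ⟨1, by simp⟩

/-- Commutativity is needed because the reversed multiplication sends `g ⊗ g'` to `g'g`, while the
target is the orbit of `gg'`. -/
theorem nonempty_radfordModule_tensor_iso (β β' : WithConv (H →ₐ[k] k)) (g g' : GroupLike k H)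
    (hcomm : (g : H) * g' = g' * g)
    (hs : ((radfordModule β g).tensor (radfordModule β' g')).IsSimple) :
    Nonempty (((radfordModule β g).tensor (radfordModule β' g')).Iso
      (radfordModule (β * β') (g * g'))) := by
  let v : orbit β.ofConv (g : H) := ⟨g, self_mem_orbit _ _⟩
  let v' : orbit β'.ofConv (g' : H) := ⟨g', self_mem_orbit _ _⟩
  have hf := (isHom_mul β β').comp (((IsHom.subtype _ (isSubmodule_orbit β.ofConv g))).tensor
    (IsHom.subtype _ (isSubmodule_orbit β'.ofConv g')))
  refine hs.nonempty_iso hf (v := v ⊗ₜ v') (c := (g' : H) * g) (w := ((g * g' : GroupLike k H) : H))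
    ?_ ?_ ?_ (isSubmodule_orbit (β * β').ofConv (g * g'))
  · change tensorCoact (radfordModule β g) (radfordModule β' g') _ = _
    rw [tensorCoact_tmul, radfordModule_coact_groupLike β g v rfl,
      radfordModule_coact_groupLike β' g' v' rfl, shuffle_tmul]
  · simp [v, v', hcomm]
  · exact (g * g').isGroupLikeElem_val.ne_zero

end
end YetterDrinfeldModule

end

theorem proposition1p5 {k : Type*} [Field k] [IsAlgClosed k] [CharZero k]
    {H : Type*} [Ring H] [HopfAlgebra k H] [FiniteDimensional k H]
    (𝒜 : ℕ → Submodule k H) [GradedAlgebra 𝒜] (h𝒜 : IsGradedHopfAlgebra 𝒜)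
    {G : Type*} [CommGroup G] [Finite G]
    (ι : MonoidAlgebra k G →ₐc[k] H) (hι : Function.Injective ι)
    (hι' : LinearMap.range (ι : MonoidAlgebra k G →ₗ[k] H) = 𝒜 0)
    (β β' : WithConv (H →ₐ[k] k)) (g g' : GroupLike k H)
    (hs : ((YetterDrinfeldModule.radfordModule β g).tensor
      (YetterDrinfeldModule.radfordModule β' g')).IsSimple) :
    Nonempty (((YetterDrinfeldModule.radfordModule β g).tensor
      (YetterDrinfeldModule.radfordModule β' g')).Iso
        (YetterDrinfeldModule.radfordModule (β * β') (g * g'))) := by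
  refine YetterDrinfeldModule.nonempty_radfordModule_tensor_iso β β' g g' ?_ hs
  -- Group-likes have degree `0`, hence come from `kG`, which is commutative because `G` is abelian.
  have hg (x : GroupLike k H) : ∃ a, ι a = (x : H) := by
    have := h𝒜.groupLike_mem x
    rwa [← hι'] at this
  obtain ⟨a, ha⟩ := hg g
  obtain ⟨b, hb⟩ := hg g'
  rw [← ha, ← hb, ← map_mul, mul_comm, map_mul]
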